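/- A represented space is a set $X$ with a surjective partial map $\delta_X:\subseteq\mathbb N^{\mathbb N}\to X$; $p$ is a name of $x$ if $\delta_X(p)=x$. A partial function $F$ on $\mathbb N^{\mathbb N}$ realizes a partial multivalued map $f:\subseteq X\rightrightarrows Y$ if $\delta_Y(F(p))\in f(\delta_X(p))$ for all $p$ with $\delta_X(p)\in\mathrm{dom}(f)$; $f$ is computable if it has a computable realizer. A computable embedding is an injective computable map whose partial inverse is computable. A computably surjective map is a surjective computable map that has a computable multivalued inverse. $\mathbb S=\{0,1\}$ is Sierpiński space, where the zero sequence is the only name of $0$ and every other sequence is a name of $1$. $\mathcal O(X)$ is the set of open sets in the final topology of $\delta_X$, where a name of $U$ is a name of its characteristic function $X\to\mathbb S$ in the standard function space representation (that is, an associate of a realizer). $\mathcal K_-(Y)$ is the space of saturated compact sets $K\subseteq Y$, a name of $K$ being a name of $\forall_K:\mathcal O(Y)\to\mathbb S$, the characteristic function of $\{U: K\subseteq U\}$; $\mathcal A_+(Y)$ is the space of closed sets $A\subseteq Y$, a name of $A$ being a name of $\exists_A:\mathcal O(Y)\to\mathbb S$, the characteristic function of $\{U: A\cap U\neq\emptyset\}$.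 Let $X$, $Y$ be represented spaces and let $B:Y\to\mathcal O(X)$, $y\mapsto B_y$. - $X$ is a computable Kolmogorov space if $\mathcal U:X\to\mathcal O\mathcal O(X)$, $x\mapsto\{U\in\mathcal O(X):x\in U\}$, is a computable embedding. - $B$ is a computable presubbase of $X$ if $x\mapsto\{y\in Y:x\in B_y\}$ is a well-defined map $X\to\mathcal O(Y)$ and a computable embedding. - $B$ is a computable prebase of $X$ if it is a computable presubbase, $X=\bigcup_{y\in Y}B_y$, and there is a total computable multivalued $R:\mathcal K_-(Y)\rightrightarrows\mathcal A_+(Y)$ with $\bigcap_{y\in K}B_y=\bigcup_{y\in A}B_y$ for all $K\in\mathcal K_-(Y)$ and $A\in R(K)$ (the empty intersection being $X$). - $B$ is a computable base of $X$ if it is a computable prebase and $\{B_y:y\in Y\}$ is a base of the final topology of $X$. - $B$ is a computable Lacombe base of $X$ if $X$ is a computable Kolmogorov space and $\mathcal A_+(Y)\to\mathcal O(X)$, $A\mapsto\bigcup_{y\in A}B_y$, is computably surjective. **Theorem.** For every represented space $X$ the following are equivalent: 1. $X$ is a computable Kolmogorov space. 2. $X$ has a computable presubbase (that is, there are a represented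 space $Y$ and a computable presubbase $B:Y\to\mathcal O(X)$ of $X$; likewise below). 3. $X$ has a computable prebase. 4. $X$ has a computable base. 5. $X$ has a computable Lacombe base. 6. $\mathrm{id}:\mathcal O(X)\to\mathcal O(X)$ is a computable Lacombe base of $X$. -/

import Mathlib

open TopologicalSpace Set

universe u v

namespace CompTop

/-- Baire space, with the product topology of discrete copies of `ℕ`. -/
abbrev Baire : Type := ℕ → ℕ

/-- The initial segment `q 0, …, q (k - 1)`. -/
def initSeg (q : Baire) (k : ℕ) : List ℕ := (List.range k).map q

/-- The natural number that codes the query `(n, q 0 … q (k - 1))`. -/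
def query (n : ℕ) (q : Baire) (k : ℕ) : ℕ := Encodable.encode (n, initSeg q k)

/-- The partial continuous function with Kleene associate `a`: the `n`-th value on input `q` is
`m` if `a` answers `m + 1` to the shortest initial segment of `q` (queried together with `n`) on
which its answer is not `0`. This is the application of Kleene's second algebra. -/
def kleeneApp (a : Baire) : Baire →. Baire := fun q =>
  ⟨∀ n, ∃ k, a (query n q k) ≠ 0, fun h n => a (query n q (Nat.find (h n))) - 1⟩

/-- A partial function on Baire space is computable if it is a restriction of a partial function
with a computable Kleene associate. -/
def BaireComputable (F : Baire →. Baire) : Prop :=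
  ∃ a : Baire, Computable a ∧ ∀ p r, r ∈ F p → r ∈ kleeneApp a p

/-- A represented space: a set with a surjective partial map from Baire space. -/
structure RepSpace : Type (u + 1) where
  carrier : Type u
  rep : Baire →. carrier
  surj : ∀ x, ∃ p, x ∈ rep p

instance : CoeSort RepSpace.{u} (Type u) := ⟨RepSpace.carrier⟩

/-- The final topology of the representation. -/
instance RepSpace.instTopologicalSpace (X : RepSpace.{u}) : TopologicalSpace X.carrier :=
  TopologicalSpace.coinduced (fun p : X.rep.Dom => X.rep.fn p.1 p.2) inferInstance

/-- `F` realizes the (partial) multivalued map `f`, whose domain is `{x | (f x).Nonempty}`. -/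
def RealizesMulti {X : RepSpace.{u}} {Y : RepSpace.{v}} (F : Baire →. Baire) (f : X → Set Y) :
    Prop :=
  ∀ p, ∀ x ∈ X.rep p, (f x).Nonempty → ∃ r ∈ F p, ∃ y ∈ Y.rep r, y ∈ f x

/-- A partial multivalued map is computable if it has a computable realizer. -/
def ComputableMulti {X : RepSpace.{u}} {Y : RepSpace.{v}} (f : X → Set Y) : Prop :=
  ∃ F : Baire →. Baire, BaireComputable F ∧ RealizesMulti F f

/-- `F` realizes the single-valued total map `f`. -/
def Realizes {X : RepSpace.{u}} {Y : RepSpace.{v}} (F : Baire →. Baire) (f : X → Y) : Prop :=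
  RealizesMulti F (fun x => ({f x} : Set Y))

/-- A single-valued total map is computable if it has a computable realizer. -/
def ComputableMap {X : RepSpace.{u}} {Y : RepSpace.{v}} (f : X → Y) : Prop :=
  ComputableMulti (fun x => ({f x} : Set Y))

/-- The inverse of `f` as a partial multivalued map, with domain the range of `f`. -/
def inverse {X : Type u} {Y : Type v} (f : X → Y) : Y → Set X := fun y => {x | f x = y}

/-- A computable embedding: injective and computable, with computable partial inverse. -/
def ComputableEmbedding {X : RepSpace.{u}} {Y : RepSpace.{v}} (f : X → Y) : Prop :=
  Function.Injective f ∧ ComputableMap f ∧ ComputableMulti (inverse f)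

/-- A computably surjective map: surjective and computable, with computable multivalued inverse. -/
def ComputablySurjective {X : RepSpace.{u}} {Y : RepSpace.{v}} (f : X → Y) : Prop :=
  Function.Surjective f ∧ ComputableMap f ∧ ComputableMulti (inverse f)

/-- Sierpiński space on the truth values; the only name of `False` is the zero sequence. -/
def sierpinski : RepSpace.{0} where
  carrier := Prop
  rep := fun p => Part.some (∃ n, p n ≠ 0)
  surj := by
    intro P
    by_cases h : P
    · exact ⟨fun _ => 1, by simp [h]⟩
    · exact ⟨fun _ => 0, by simp [h]⟩

/-- `p` is a name of the characteristic function `f : X → 𝕊` in the function space representation: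
the partial function with associate `p` realizes `f`. -/
def NamesChar {X : RepSpace.{u}} (p : Baire) (f : X → Prop) : Prop :=
  Realizes (Y := sierpinski) (kleeneApp p) f

/-- The partial map whose graph is the relation `R`. -/
noncomputable def partialOfRel {α : Type u} (R : Baire → α → Prop) : Baire →. α :=
  fun p => ⟨∃ x, R p x, fun h => h.choose⟩

theorem mem_partialOfRel {α : Type u} {R : Baire → α → Prop}
    (hR : ∀ p x y, R p x → R p y → x = y) {p : Baire} {x : α} :
    x ∈ partialOfRel R p ↔ R p x := by
  constructor
  · rintro ⟨h, rfl⟩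
    exact h.choose_spec
  · intro h
    exact ⟨⟨x, h⟩, hR _ _ _ (Exists.choose_spec (⟨x, h⟩ : ∃ x, R p x)) h⟩

theorem namesChar_iff {X : RepSpace.{u}} {p : Baire} {f : X → Prop} :
    NamesChar p f ↔ ∀ q, ∀ x ∈ X.rep q, ∃ r ∈ kleeneApp p q, ((∃ n, r n ≠ 0) ↔ f x) := by
  constructor
  · intro h q x hx
    obtain ⟨r, hr, y, hy, hyf⟩ := h q x hx ⟨_, rfl⟩
    refine ⟨r, hr, ?_⟩
    have h1 : y = (∃ n, r n ≠ 0) := Part.mem_some_iff.1 hy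
    have h2 : y = f x := hyf
    exact iff_of_eq (h1.symm.trans h2)
  · intro h q x hx _
    obtain ⟨r, hr, hf⟩ := h q x hx
    exact ⟨r, hr, _, Part.mem_some _, propext hf⟩

theorem namesChar_unique {X : RepSpace.{u}} {p : Baire} {f g : X → Prop}
    (hf : NamesChar p f) (hg : NamesChar p g) : f = g := by
  funext x
  obtain ⟨q, hq⟩ := X.surj x
  obtain ⟨r, hr, h1⟩ := namesChar_iff.1 hf q x hq
  obtain ⟨s, hs, h2⟩ := namesChar_iff.1 hg q x hq
  obtain rfl := Part.mem_unique hr hs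
  exact propext (h1.symm.trans h2)

theorem isOpen_baire_iff {s : Set Baire} :
    IsOpen s ↔ ∀ q ∈ s, ∃ k, ∀ q' : Baire, (∀ i < k, q' i = q i) → q' ∈ s := by
  constructor
  · intro hs q hq
    obtain ⟨I, t, hI, hsub⟩ := isOpen_pi_iff.1 hs q hq
    refine ⟨I.sup id + 1, fun q' h => hsub fun i hi => ?_⟩
    have : i ≤ I.sup id := Finset.le_sup (f := id) hi
    rw [h i (by omega)]
    exact (hI i hi).2
  · intro h
    refine isOpen_pi_iff.2 fun q hq => ?_
    obtain ⟨k, hk⟩ := h q hq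
    refine ⟨Finset.range k, fun i => {q i}, fun i _ => ⟨isOpen_discrete _, rfl⟩, fun q' hq' => ?_⟩
    exact hk q' fun i hi => hq' i (by simpa using hi)

/-- A set is open in the final topology iff membership of a point is witnessed by an initial
segment of each of its names. -/
theorem isOpen_iff {X : RepSpace.{u}} {U : Set X} :
    IsOpen U ↔ ∀ q, ∀ x ∈ X.rep q, x ∈ U →
      ∃ k, ∀ q', (∀ i < k, q' i = q i) → ∀ x' ∈ X.rep q', x' ∈ U := by
  rw [isOpen_coinduced, isOpen_induced_iff]
  constructor
  · rintro ⟨t, ht, h⟩ q x hx hxU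
    have hd : q ∈ X.rep.Dom := Part.dom_iff_mem.2 ⟨x, hx⟩
    have hq : q ∈ t := by
      have : (⟨q, hd⟩ : X.rep.Dom) ∈ Subtype.val ⁻¹' t := by
        rw [h]
        have h0 : X.rep.fn q hd = x := Part.get_eq_of_mem hx hd
        change X.rep.fn q hd ∈ U
        rwa [h0]
      exact this
    obtain ⟨k, hk⟩ := isOpen_baire_iff.1 ht q hq
    refine ⟨k, fun q' hq' x' hx' => ?_⟩
    have hd' : q' ∈ X.rep.Dom := Part.dom_iff_mem.2 ⟨x', hx'⟩
    have h3 : (⟨q', hd'⟩ : X.rep.Dom) ∈ Subtype.val ⁻¹' t := hk q' hq'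
    rw [h] at h3
    have h4 : X.rep.fn q' hd' = x' := Part.get_eq_of_mem hx' hd'
    change X.rep.fn q' hd' ∈ U at h3
    rwa [h4] at h3
  · intro h
    refine ⟨{q | ∃ k, ∀ q', (∀ i < k, q' i = q i) → ∀ x' ∈ X.rep q', x' ∈ U}, ?_, ?_⟩
    · refine isOpen_baire_iff.2 ?_
      rintro q ⟨k, hk⟩
      exact ⟨k, fun q' hq' => ⟨k, fun q'' h'' =>
        hk q'' fun i hi => (h'' i hi).trans (hq' i hi)⟩⟩
    · ext ⟨q, hd⟩
      constructor
      · rintro ⟨k, hk⟩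
        exact hk q (fun _ _ => rfl) _ (Part.get_mem hd)
      · intro hq
        exact h q _ (Part.get_mem hd) hq

theorem initSeg_eq_iff {q q' : Baire} {k : ℕ} :
    initSeg q k = initSeg q' k ↔ ∀ i < k, q i = q' i := by
  simp [initSeg]

theorem mem_kleeneApp {a q r : Baire} :
    r ∈ kleeneApp a q ↔
      ∀ n, ∃ k, a (query n q k) = r n + 1 ∧ ∀ j < k, a (query n q j) = 0 := by
  constructor
  · rintro ⟨h, rfl⟩ n
    refine ⟨Nat.find (h n), ?_, fun j hj => not_not.1 (Nat.find_min (h n) hj)⟩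
    have := Nat.find_spec (h n)
    change _ = a (query n q (Nat.find (h n))) - 1 + 1
    omega
  · intro h
    have hd : ∀ n, ∃ k, a (query n q k) ≠ 0 := fun n => by
      obtain ⟨k, hk, -⟩ := h n
      exact ⟨k, by omega⟩
    refine ⟨hd, funext fun n => ?_⟩
    obtain ⟨k, hk, hmin⟩ := h n
    have : Nat.find (hd n) = k :=
      (Nat.find_eq_iff _).2 ⟨by omega, fun j hj => not_not.2 (hmin j hj)⟩
    change a (query n q (Nat.find (hd n))) - 1 = r n
    rw [this, hk]
    rfl

/-- Characteristic functions of open sets have names. -/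
theorem exists_namesChar {X : RepSpace.{u}} {U : Set X} (hU : IsOpen U) :
    ∃ p, NamesChar p (fun x : X => x ∈ U) := by
  classical
  let W : List ℕ → Prop := fun s => ∀ q', initSeg q' s.length = s → ∀ x' ∈ X.rep q', x' ∈ U
  let a : Baire := fun c =>
    match (Encodable.decode c : Option (ℕ × List ℕ)) with
    | none => 0
    | some (n, s) => if s.length < n then 0 else if W s then 2 else 1
  have ha : ∀ n q k, a (query n q k) =
      if k < n then 0 else if W (initSeg q k) then 2 else 1 := by
    intro n q k
    have : (initSeg q k).length = k := by simp [initSeg]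
    simp only [a, query, Encodable.encodek, this]
  refine ⟨a, namesChar_iff.2 fun q x hx => ?_⟩
  refine ⟨fun n => if W (initSeg q n) then 1 else 0, mem_kleeneApp.2 fun n => ⟨n, ?_, ?_⟩, ?_⟩
  · rw [ha]
    by_cases h : W (initSeg q n) <;> simp [h]
  · intro j hj
    rw [ha]
    simp [hj]
  · have hlen : ∀ n, (initSeg q n).length = n := fun n => by simp [initSeg]
    constructor
    · rintro ⟨n, hn⟩
      have hW : W (initSeg q n) := by
        by_contra h
        simp [h] at hn
      exact hW q (by rw [hlen]) x hx
    · intro hxU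
      obtain ⟨k, hk⟩ := isOpen_iff.1 hU q x hx hxU
      refine ⟨k, ?_⟩
      have hW : W (initSeg q k) := by
        intro q' hq'
        rw [hlen] at hq'
        exact hk q' (initSeg_eq_iff.1 hq')
      simp [hW]

/-- A positive answer of a name `p` on input `q` depends only on finite parts of `p` and `q`. -/
theorem namesChar_locally {X : RepSpace.{u}} {p : Baire} {f : X → Prop} (hp : NamesChar p f)
    {q : Baire} {x : X} (hx : x ∈ X.rep q) (hf : f x) :
    ∃ M, ∀ p', (∀ i < M, p' i = p i) → ∀ g : X → Prop, NamesChar p' g →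
      ∀ q', (∀ i < M, q' i = q i) → ∀ x' ∈ X.rep q', g x' := by
  obtain ⟨r, hr, h⟩ := namesChar_iff.1 hp q x hx
  obtain ⟨n, hn⟩ := h.2 hf
  obtain ⟨k, hk, hmin⟩ := mem_kleeneApp.1 hr n
  refine ⟨k + (Finset.range (k + 1)).sup (fun j => query n q j) + 1,
    fun p' hp' g hg q' hq' x' hx' => ?_⟩
  have key : ∀ j ≤ k, p' (query n q' j) = p (query n q j) := by
    intro j hj
    have h1 : query n q' j = query n q j := by
      simp only [query]
      rw [initSeg_eq_iff.2 fun i hi => hq' i (by omega)]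
    rw [h1]
    have h2 : query n q j ≤ (Finset.range (k + 1)).sup (fun j => query n q j) :=
      Finset.le_sup (f := fun j => query n q j) (Finset.mem_range.2 (by omega))
    exact hp' _ (by omega)
  obtain ⟨r', hr', h'⟩ := namesChar_iff.1 hg q' x' hx'
  refine h'.1 ⟨n, ?_⟩
  obtain ⟨k', hk', hmin'⟩ := mem_kleeneApp.1 hr' n
  have hkk : k' = k := by
    rcases lt_trichotomy k' k with hlt | heq | hlt
    · have := key k' hlt.le
      rw [hmin k' hlt] at this
      omega
    · exact heq
    · have := key k le_rfl
      rw [hmin' k hlt] at this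
      omega
  subst hkk
  have := key k' le_rfl
  omega

theorem namesOpen_unique {X : RepSpace.{u}} (p : Baire) (U V : Opens X)
    (hU : NamesChar p (fun x : X => x ∈ U)) (hV : NamesChar p (fun x : X => x ∈ V)) : U = V := by
  ext x
  exact iff_of_eq (congrFun (namesChar_unique hU hV) x)

/-- The space `𝒪(X)` of open subsets; a name of `U` is a name of its characteristic function. -/
noncomputable def opens (X : RepSpace.{u}) : RepSpace.{u} where
  carrier := Opens X
  rep := partialOfRel fun p U => NamesChar p (fun x : X => x ∈ U)
  surj := fun U => by
    obtain ⟨p, hp⟩ := exists_namesChar U.isOpen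
    exact ⟨p, (mem_partialOfRel namesOpen_unique).2 hp⟩

theorem mem_opens_rep {X : RepSpace.{u}} {p : Baire} {U : Opens X} :
    U ∈ (opens X).rep p ↔ NamesChar p (fun x : X => x ∈ U) :=
  mem_partialOfRel namesOpen_unique

/-- A point of `𝒪(X)` as an open subset of `X`. -/
def asOpens {X : RepSpace.{u}} (U : opens X) : Opens X := U

/-- The saturated compact subsets: those that are the intersection of their open supersets. -/
def SatCompacts (Y : Type u) [TopologicalSpace Y] : Type u :=
  {K : Set Y // IsCompact K ∧ ⋂₀ {U : Set Y | IsOpen U ∧ K ⊆ U} = K}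

/-- The universal quantifier `∀_K` of a set `K`, as the characteristic function of
`{U | K ⊆ U}`. -/
def forallOn {Y : RepSpace.{u}} (K : Set Y) : opens Y → Prop := fun U : Opens Y => K ⊆ (U : Set Y)

/-- The existential quantifier `∃_A` of a set `A`, as the characteristic function of
`{U | (A ∩ U).Nonempty}`. -/
def existsOn {Y : RepSpace.{u}} (A : Set Y) : opens Y → Prop :=
  fun U : Opens Y => (A ∩ (U : Set Y)).Nonempty

theorem isOpen_forallOn {Y : RepSpace.{u}} {K : Set Y} (hK : IsCompact K) :
    IsOpen {U : opens Y | forallOn K U} := by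
  refine isOpen_iff.2 fun p U hpU hKU => ?_
  by_contra hcon
  push Not at hcon
  choose p' hp' V hV hKV using hcon
  have hp : NamesChar p (fun y : Y => y ∈ asOpens U) := mem_opens_rep.1 hpU
  have hpV : ∀ n, NamesChar (p' n) (fun y : Y => y ∈ asOpens (V n)) :=
    fun n => mem_opens_rep.1 (hV n)
  let W : ℕ → Set Y := fun N => {y | y ∈ asOpens U ∧ ∀ n, N ≤ n → y ∈ asOpens (V n)}
  have hloc : ∀ q, ∀ y ∈ Y.rep q, y ∈ asOpens U → ∃ M, ∀ q', (∀ i < M, q' i = q i) →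
      ∀ y' ∈ Y.rep q', y' ∈ W M := by
    intro q y hy hyU
    obtain ⟨M, hM⟩ := namesChar_locally hp hy hyU
    refine ⟨M, fun q' hq' y' hy' => ⟨hM p (fun _ _ => rfl) _ hp q' hq' y' hy', fun n hn => ?_⟩⟩
    exact hM (p' n) (fun i hi => hp' n i (by omega)) _ (hpV n) q' hq' y' hy'
  have hWo : ∀ N, IsOpen (W N) := by
    intro N
    refine isOpen_iff.2 fun q y hy hyW => ?_
    obtain ⟨M, hM⟩ := hloc q y hy hyW.1
    have hfin : IsOpen (⋂ n ∈ Finset.Ico N M, (asOpens (V n) : Set Y)) :=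
      isOpen_biInter_finset fun n _ => (asOpens (V n)).isOpen
    have hyf : y ∈ ⋂ n ∈ Finset.Ico N M, (asOpens (V n) : Set Y) :=
      mem_iInter₂.2 fun n hn => hyW.2 n (Finset.mem_Ico.1 hn).1
    obtain ⟨k, hk⟩ := isOpen_iff.1 hfin q y hy hyf
    refine ⟨max k M, fun q' hq' y' hy' => ?_⟩
    have h1 := hM q' (fun i hi => hq' i (lt_max_of_lt_right hi)) y' hy'
    have h2 := hk q' (fun i hi => hq' i (lt_max_of_lt_left hi)) y' hy'
    refine ⟨h1.1, fun n hn => ?_⟩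
    by_cases hnM : M ≤ n
    · exact h1.2 n hnM
    · exact mem_iInter₂.1 h2 n (Finset.mem_Ico.2 ⟨hn, by omega⟩)
  have hcov : K ⊆ ⋃ N, W N := by
    intro y hy
    obtain ⟨q, hq⟩ := Y.surj y
    obtain ⟨M, hM⟩ := hloc q y hq (hKU hy)
    exact mem_iUnion.2 ⟨M, hM q (fun _ _ => rfl) y hq⟩
  have hdir : Directed (· ⊆ ·) W :=
    directed_of_isDirected_le fun a b hab y hy => ⟨hy.1, fun n hn => hy.2 n (hab.trans hn)⟩
  obtain ⟨N, hN⟩ := hK.elim_directed_cover W hWo hcov hdir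
  exact hKV N fun y hy => (hN hy).2 N le_rfl

theorem isOpen_existsOn {Y : RepSpace.{u}} (A : Set Y) :
    IsOpen {U : opens Y | existsOn A U} := by
  refine isOpen_iff.2 fun p U hpU hAU => ?_
  obtain ⟨y, hyA, hyU⟩ := hAU
  obtain ⟨q, hq⟩ := Y.surj y
  obtain ⟨M, hM⟩ := namesChar_locally (mem_opens_rep.1 hpU) hq hyU
  exact ⟨M, fun p' hp' V hV => ⟨y, hyA, hM p' hp' _ (mem_opens_rep.1 hV) q (fun _ _ => rfl) y hq⟩⟩

theorem namesSatCompact_unique {Y : RepSpace.{u}} (p : Baire) (K L : SatCompacts Y)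
    (hK : NamesChar p (forallOn K.1)) (hL : NamesChar p (forallOn L.1)) : K = L := by
  have h := namesChar_unique hK hL
  have h' : ∀ U : Set Y, IsOpen U → (K.1 ⊆ U ↔ L.1 ⊆ U) := fun U hU =>
    iff_of_eq (congrFun h (⟨U, hU⟩ : Opens Y))
  apply Subtype.ext
  rw [← K.2.2, ← L.2.2]
  congr 1
  ext U
  exact and_congr_right (h' U)

theorem namesClosed_unique {Y : RepSpace.{u}} (p : Baire) (A B : Closeds Y)
    (hA : NamesChar p (existsOn (A : Set Y))) (hB : NamesChar p (existsOn (B : Set Y))) :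
    A = B := by
  have h := namesChar_unique hA hB
  have h' : ∀ U : Set Y, IsOpen U → (((A : Set Y) ∩ U).Nonempty ↔ ((B : Set Y) ∩ U).Nonempty) :=
    fun U hU => iff_of_eq (congrFun h (⟨U, hU⟩ : Opens Y))
  ext y
  have hA' := h' _ A.isClosed.isOpen_compl
  have hB' := h' _ B.isClosed.isOpen_compl
  simp only [inter_compl_self, Set.not_nonempty_empty, false_iff, iff_false] at hA' hB'
  constructor
  · intro hy
    by_contra hn
    exact hB' ⟨y, hy, hn⟩
  · intro hy
    by_contra hn
    exact hA' ⟨y, hy, hn⟩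

/-- The space `𝒦₋(Y)` of saturated compact subsets; a name of `K` is a name of
`∀_K : 𝒪(Y) → 𝕊`. -/
noncomputable def satCompacts (Y : RepSpace.{u}) : RepSpace.{u} where
  carrier := SatCompacts Y
  rep := partialOfRel fun p K => NamesChar p (forallOn K.1)
  surj := fun K => by
    obtain ⟨p, hp⟩ := exists_namesChar (isOpen_forallOn K.2.1)
    exact ⟨p, (mem_partialOfRel namesSatCompact_unique).2 hp⟩

/-- The space `𝒜₊(Y)` of closed subsets; a name of `A` is a name of `∃_A : 𝒪(Y) → 𝕊`. -/
noncomputable def closedsPos (Y : RepSpace.{u}) : RepSpace.{u} where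
  carrier := Closeds Y
  rep := partialOfRel fun p A => NamesChar p (existsOn (A : Set Y))
  surj := fun A => by
    obtain ⟨p, hp⟩ := exists_namesChar (isOpen_existsOn (A : Set Y))
    exact ⟨p, (mem_partialOfRel namesClosed_unique).2 hp⟩

/-- The neighborhood map `x ↦ {U ∈ 𝒪(X) | x ∈ U}`; the set is open because it is the set of open
supersets of the compact set `{x}`. -/
def nhdMap (X : RepSpace.{u}) : X → opens (opens X) := fun x =>
  (⟨{U : opens X | x ∈ asOpens U}, by
    have h := isOpen_forallOn (isCompact_singleton (x := x))
    simp only [forallOn, singleton_subset_iff] at h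
    exact h⟩ : Opens (opens X))

/-- `X` is a computable Kolmogorov space. -/
def ComputableKolmogorov (X : RepSpace.{u}) : Prop := ComputableEmbedding (nhdMap X)

/-- `B : Y → 𝒪(X)` is a computable presubbase of `X`: the transpose `x ↦ {y | x ∈ B y}` is well
defined as a map to `𝒪(Y)` and is a computable embedding. -/
def ComputablePresubbase (X : RepSpace.{u}) (Y : RepSpace.{v}) (B : Y → Opens X) : Prop :=
  ∃ h : ∀ x : X, IsOpen {y : Y | x ∈ B y},
    ComputableEmbedding (X := X) (Y := opens Y)
      (fun x => (⟨{y : Y | x ∈ B y}, h x⟩ : Opens Y))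

/-- `B` is a computable prebase of `X`: a computable presubbase with union `X` for which some total
computable multivalued map turns compact intersections into overt unions. The empty intersection
is `X`. -/
def ComputablePrebase (X : RepSpace.{u}) (Y : RepSpace.{v}) (B : Y → Opens X) : Prop :=
  ComputablePresubbase X Y B ∧
  (∃ R : SatCompacts Y → Set (Closeds Y),
    (∀ K, (R K).Nonempty) ∧
    ComputableMulti (X := satCompacts Y) (Y := closedsPos Y) R ∧
    ∀ K, ∀ A ∈ R K, ⋂ y ∈ K.1, (B y : Set X) = ⋃ y ∈ A, (B y : Set X)) ∧
  ⋃ y, (B y : Set X) = univ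

/-- `B` is a computable base of `X`: a computable prebase that is a base of the final topology. -/
def ComputableBase (X : RepSpace.{u}) (Y : RepSpace.{v}) (B : Y → Opens X) : Prop :=
  ComputablePrebase X Y B ∧ IsTopologicalBasis (range fun y => (B y : Set X))

/-- `B` is a computable Lacombe base of the computable Kolmogorov space `X`: the union map
`𝒜₊(Y) → 𝒪(X)` is computably surjective. -/
def ComputableLacombeBase (X : RepSpace.{u}) (Y : RepSpace.{v}) (B : Y → Opens X) : Prop :=
  ComputableKolmogorov X ∧
  ComputablySurjective (X := closedsPos Y) (Y := opens X)
    (fun A : Closeds Y => (⨆ y ∈ A, B y : Opens X))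

end CompTop

/-!
A computable map is determined by finite approximations: the application `kleeneApp a q` of Kleene's
second algebra can be evaluated on finite parts of `a` and `q`. Hence a functional of two arguments
that is built from projections and application can be curried, that is, an associate of its second
section is computable from its first argument. This gives computable evaluation `X → 𝒪𝒪(X)` and
computable preimage maps `𝒪(Y) → 𝒪(X)`, and therefore the transpose `X → 𝒪(Y)` of every computable
`B : Y → 𝒪(X)` is computable.

The quantifiers embed `𝒜₊(Y)` and `𝒦₋(Y)` into `𝒪𝒪(Y)`, and `x ∈ ⋃ y ∈ A, B y` iff the transpose of
`x` belongs to `∃_A`, and `x ∈ ⋂ y ∈ K, B y` iff it belongs to `∀_K`. So overt unions and compact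
intersections are preimages under the transpose. Since `∃` of the closure of `{y}` is the
neighborhood filter of `y`, every `B y` is in turn the overt union over the closure of `{y}`; for
`B = id` this makes the union map computably surjective. Conversely, the transpose of a presubbase
`B` is the composition of `x ↦ {U | x ∈ U}` with the preimage map of `B`, and the first factor of a
computable embedding is a computable embedding.
-/

namespace CompTop

open Filter

universe w

theorem length_initSeg (q : Baire) (k : ℕ) : (initSeg q k).length = k := by
  simp [initSeg]

theorem initSeg_getElem?_eq_some {q : Baire} {k n v : ℕ} :
    (initSeg q k)[n]? = some v ↔ n < k ∧ q n = v := by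
  by_cases h : n < k <;> simp [initSeg, h]

theorem initSeg_prefix (q : Baire) {k k' : ℕ} (h : k ≤ k') : initSeg q k <+: initSeg q k' := by
  obtain ⟨d, rfl⟩ := Nat.exists_eq_add_of_le h
  simp [initSeg, List.range_add]

theorem le_query (n : ℕ) (q : Baire) (k : ℕ) : k ≤ query n q k :=
  calc k = (initSeg q k).length := (length_initSeg q k).symm
    _ ≤ Encodable.encode (initSeg q k) := Encodable.length_le_encode _
    _ ≤ query n q k := Nat.right_le_pair _ _

/-- A partial sequence `f` is refined by `g` if `g` has all values of `f`. Partial sequences serve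
as the finite approximations to points of Baire space. -/
def Refines (f g : ℕ → Option ℕ) : Prop := ∀ ⦃i v⦄, f i = some v → g i = some v

theorem Refines.mapM {f g : ℕ → Option ℕ} (h : Refines f g) {l m : List ℕ}
    (hl : l.mapM f = some m) : l.mapM g = some m := by
  induction l generalizing m with
  | nil => exact hl
  | cons i l ih =>
    simp only [List.mapM_cons, Option.bind_eq_bind, Option.pure_def, Option.bind_eq_some_iff,
      Option.some.injEq] at hl ⊢
    obtain ⟨v, hv, m', hm', rfl⟩ := hl
    exact ⟨v, h hv, m', ih hm', rfl⟩

theorem mapM_eq_some_map {g : ℕ → Option ℕ} {q : Baire} {l : List ℕ}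
    (h : ∀ i ∈ l, g i = some (q i)) : l.mapM g = some (l.map q) := by
  induction l with
  | nil => rfl
  | cons i l ih =>
    rw [List.forall_mem_cons] at h
    simp [List.mapM_cons, h.1, ih h.2]

/-- The first entry of `h 0, …, h (k - 1)` other than `some 0`, or `some 0` if there is none. This
is the search in `kleeneApp`, cut off after `k` steps: it stops with `none` at an unknown entry. -/
def firstNonzero (h : ℕ → Option ℕ) : ℕ → Option ℕ
  | 0 => some 0
  | k + 1 => (firstNonzero h k).bind fun t => bif t == 0 then h k else some t

theorem firstNonzero_eq_zero {h : ℕ → Option ℕ} {k : ℕ} :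
    firstNonzero h k = some 0 ↔ ∀ j < k, h j = some 0 := by
  induction k with
  | zero => simp [firstNonzero]
  | succ k ih =>
    rw [firstNonzero, Nat.forall_lt_succ_right, ← ih]
    rcases firstNonzero h k with _ | _ | t <;> simp

theorem firstNonzero_eq_succ {h : ℕ → Option ℕ} {k v : ℕ} :
    firstNonzero h k = some (v + 1) ↔ ∃ i < k, h i = some (v + 1) ∧ ∀ j < i, h j = some 0 := by
  induction k with
  | zero => simp [firstNonzero]
  | succ k ih =>
    rw [firstNonzero, Nat.exists_lt_succ_right, ← ih, ← firstNonzero_eq_zero]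
    rcases firstNonzero h k with _ | _ | t <;> simp

/-- The answer of the partially known associate `f` to the query `n` about the initial segment of
length `k` of the partially known sequence `g`. -/
def answer (f g : ℕ → Option ℕ) (n k : ℕ) : Option ℕ :=
  ((List.range k).mapM g).bind fun l => f (Encodable.encode (n, l))

theorem Refines.answer {f f' g g' : ℕ → Option ℕ} (hf : Refines f f') (hg : Refines g g') (n : ℕ) :
    Refines (answer f g n) (answer f' g' n) := by
  intro k v h
  obtain ⟨l, hl, hv⟩ := Option.bind_eq_some_iff.1 h
  exact Option.bind_eq_some_iff.2 ⟨l, hg.mapM hl, hf hv⟩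

theorem answer_eq_query {f g : ℕ → Option ℕ} {q : Baire} {k : ℕ}
    (hg : ∀ i < k, g i = some (q i)) (n : ℕ) : answer f g n k = f (query n q k) := by
  simp only [answer, mapM_eq_some_map (fun i hi => hg i (List.mem_range.1 hi)),
    Option.bind_some, query, initSeg]

/-- The `n`-th value of the application of the partially known associate `f` to the partially
known sequence `g`, as far as the first `K` queries determine it. -/
def applyApprox (f g : ℕ → Option ℕ) (K n : ℕ) : Option ℕ :=
  (firstNonzero (answer f g n) K).bind Nat.ppred

theorem applyApprox_eq_some {f g : ℕ → Option ℕ} {K n v : ℕ} :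
    applyApprox f g K n = some v ↔
      ∃ i < K, answer f g n i = some (v + 1) ∧ ∀ j < i, answer f g n j = some 0 := by
  simp only [applyApprox, Option.bind_eq_some_iff, Nat.ppred_eq_some, Nat.succ_eq_add_one,
    exists_eq_right', firstNonzero_eq_succ]

theorem Refines.applyApprox {f f' g g' : ℕ → Option ℕ} (hf : Refines f f') (hg : Refines g g')
    {K K' : ℕ} (hK : K ≤ K') : Refines (applyApprox f g K) (applyApprox f' g' K') := by
  intro n v h
  obtain ⟨i, hi, hv, h0⟩ := applyApprox_eq_some.1 h
  exact applyApprox_eq_some.2 ⟨i, hi.trans_le hK, hf.answer hg n hv, fun j hj =>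
    hf.answer hg n (h0 j hj)⟩

theorem exists_applyApprox_eq {a q r : Baire} (hr : r ∈ kleeneApp a q) (n : ℕ) :
    ∃ N, ∀ f g : ℕ → Option ℕ, (∀ i < N, f i = some (a i)) → (∀ i < N, g i = some (q i)) →
      applyApprox f g N n = some (r n) := by
  obtain ⟨k, hk, hmin⟩ := mem_kleeneApp.1 hr n
  obtain ⟨N, hN⟩ := ((Set.finite_Iic k).image (query n q)).bddAbove
  have hquery : ∀ j ≤ k, query n q j < N + 1 := fun j hj =>
    Nat.lt_succ_of_le (hN (mem_image_of_mem _ hj))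
  refine ⟨N + 1, fun f g hf hg => ?_⟩
  have hanswer : ∀ j ≤ k, answer f g n j = some (a (query n q j)) := fun j hj => by
    have hj' : j < N + 1 := (le_query n q j).trans_lt (hquery j hj)
    rw [answer_eq_query (fun i hi => hg i (hi.trans hj')), hf _ (hquery j hj)]
  refine applyApprox_eq_some.2 ⟨k, (le_query n q k).trans_lt (hquery k le_rfl), ?_, fun j hj => ?_⟩
  · rw [hanswer k le_rfl, hk]
  · rw [hanswer j hj.le, hmin j hj]

section Computability

variable {α : Type*} [Primcodable α]

theorem computable_mapM_range {g : α → ℕ → Option ℕ} (hg : Computable₂ g) {k : α → ℕ}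
    (hk : Computable k) : Computable fun a => (List.range (k a)).mapM (g a) := by
  have hstep : Computable₂ fun (a : α) (x : ℕ × Option (List ℕ)) =>
      x.2.bind fun l => (g a x.1).map fun v => l ++ [v] :=
    Computable.option_bind (Computable.snd.comp Computable.snd) <|
      Computable.option_map (hg.comp (Computable.fst.comp Computable.fst)
        (Computable.fst.comp (Computable.snd.comp Computable.fst)))
        (Computable.list_concat.comp (Computable.snd.comp Computable.fst) Computable.snd)
  refine (Computable.nat_rec hk (Computable.const (some [])) hstep).of_eq fun a => ?_
  induction k a with
  | zero => rfl
  | succ k ih =>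
    simp only [ih, List.range_succ, List.mapM_append]
    cases (List.range k).mapM (g a) <;> cases h : g a k <;> simp [h]

theorem computable_firstNonzero {h : α → ℕ → Option ℕ} (hh : Computable₂ h) {k : α → ℕ}
    (hk : Computable k) : Computable fun a => firstNonzero (h a) (k a) := by
  have hstep : Computable₂ fun (a : α) (x : ℕ × Option ℕ) =>
      x.2.bind fun t => bif t == 0 then h a x.1 else some t :=
    Computable.option_bind (Computable.snd.comp Computable.snd) <|
      Computable.cond (Primrec.beq.to_comp.comp Computable.snd (Computable.const 0))
        (hh.comp (Computable.fst.comp Computable.fst)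
          (Computable.fst.comp (Computable.snd.comp Computable.fst)))
        (Computable.option_some.comp Computable.snd)
  refine (Computable.nat_rec hk (Computable.const (some 0)) hstep).of_eq fun a => ?_
  induction k a with
  | zero => rfl
  | succ k ih => simp only [ih, firstNonzero]

theorem computable_answer {f g : α → ℕ → Option ℕ} (hf : Computable₂ f) (hg : Computable₂ g)
    {n k : α → ℕ} (hn : Computable n) (hk : Computable k) :
    Computable fun a => answer (f a) (g a) (n a) (k a) :=
  Computable.option_bind (computable_mapM_range hg hk) <|
    hf.comp Computable.fst
      (Computable.encode.comp ((hn.comp Computable.fst).pair Computable.snd))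

theorem computable_applyApprox {f g : α → ℕ → Option ℕ} (hf : Computable₂ f)
    (hg : Computable₂ g) {K n : α → ℕ} (hK : Computable K) (hn : Computable n) :
    Computable fun a => applyApprox (f a) (g a) (K a) (n a) := by
  have hanswer : Computable₂ fun a k => answer (f a) (g a) (n a) k :=
    computable_answer (α := α × ℕ) (f := fun x => f x.1) (g := fun x => g x.1)
      (hf.comp (Computable.fst.comp Computable.fst) Computable.snd)
      (hg.comp (Computable.fst.comp Computable.fst) Computable.snd)
      (hn.comp Computable.fst) Computable.snd
  have hppred : Computable Nat.ppred :=
    (Computable.nat_casesOn (h := fun _ m => some m) Computable.id (Computable.const none)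
      (Computable.option_some.comp Computable.snd)).of_eq fun m => by cases m <;> rfl
  exact Computable.option_bind (computable_firstNonzero hanswer hK) (hppred.comp Computable.snd)

end Computability

/-- `φ` approximates the partial functional `Φ`: it computes the values of `Φ` from initial
segments of the arguments, and longer initial segments do not change a value. -/
structure Approximates (φ : List ℕ → List ℕ → ℕ → Option ℕ) (Φ : Baire → Baire →. Baire) :
    Prop where
  refines : ∀ {l l' m m'}, l <+: l' → m <+: m' → Refines (φ l m) (φ l' m')
  converges : ∀ {p q r}, r ∈ Φ p q → ∀ n, ∃ k, φ (initSeg p k) (initSeg q k) n = some (r n)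

namespace Approximates

variable {φ : List ℕ → List ℕ → ℕ → Option ℕ} {Φ : Baire → Baire →. Baire} {p q r : Baire}

theorem eventually_eq (h : Approximates φ Φ) (hr : r ∈ Φ p q) (n : ℕ) :
    ∀ᶠ k in atTop, φ (initSeg p k) (initSeg q k) n = some (r n) := by
  obtain ⟨k, hk⟩ := h.converges hr n
  exact eventually_atTop.2 ⟨k, fun k' hk' =>
    h.refines (initSeg_prefix p hk') (initSeg_prefix q hk') hk⟩

theorem eventually_eq_below (h : Approximates φ Φ) (hr : r ∈ Φ p q) (N : ℕ) :
    ∀ᶠ k in atTop, ∀ n < N, φ (initSeg p k) (initSeg q k) n = some (r n) :=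
  (eventually_all_finite (Set.finite_lt_nat N)).2 fun n _ => h.eventually_eq hr n

theorem eq_of_mem (h : Approximates φ Φ) (hr : r ∈ Φ p q) {j k n v : ℕ}
    (hv : φ (initSeg p j) (initSeg q k) n = some v) : v = r n := by
  obtain ⟨K, hK, hj, hk⟩ := ((h.eventually_eq hr n).and
    ((eventually_ge_atTop j).and (eventually_ge_atTop k))).exists
  have hv' := h.refines (initSeg_prefix p hj) (initSeg_prefix q hk) hv
  exact Option.some_injective _ (hv'.symm.trans hK)

end Approximates

/-- A partial functional of two arguments is computable if it has a computable approximation. -/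
def ComputableFunctional (Φ : Baire → Baire →. Baire) : Prop :=
  ∃ φ : List ℕ → List ℕ → ℕ → Option ℕ,
    Computable (fun x : (List ℕ × List ℕ) × ℕ => φ x.1.1 x.1.2 x.2) ∧ Approximates φ Φ

/-- The associate that answers `v + 1` when `φ` gives the value `some v`, and `0` when `φ` gives
`none`. -/
def associate (φ : List ℕ → ℕ → Option ℕ) : Baire := fun c =>
  Encodable.encode ((Encodable.decode c : Option (ℕ × List ℕ)).bind fun x => φ x.2 x.1)

theorem associate_query (φ : List ℕ → ℕ → Option ℕ) (n : ℕ) (q : Baire) (k : ℕ) :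
    associate φ (query n q k) = Encodable.encode (φ (initSeg q k) n) := by
  simp [associate, query]

theorem computable_associate {α : Type*} [Primcodable α] {φ : α → List ℕ → ℕ → Option ℕ}
    (hφ : Computable fun x : (α × List ℕ) × ℕ => φ x.1.1 x.1.2 x.2) :
    Computable₂ fun a => associate (φ a) := by
  have harg : Computable fun y : (α × ℕ) × (ℕ × List ℕ) => ((y.1.1, y.2.2), y.2.1) :=
    ((Computable.fst.comp Computable.fst).pair (Computable.snd.comp Computable.snd)).pair
      (Computable.fst.comp Computable.snd)
  exact Computable.encode.comp <|
    Computable.option_bind (Computable.decode.comp Computable.snd) (hφ.comp harg)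

theorem mem_kleeneApp_of_encode {a q r : Baire} {h : ℕ → ℕ → Option ℕ}
    (ha : ∀ n k, a (query n q k) = Encodable.encode (h n k))
    (hval : ∀ n k v, h n k = some v → v = r n) (hconv : ∀ n, ∃ k, h n k = some (r n)) :
    r ∈ kleeneApp a q := by
  classical
  have hex : ∀ n, ∃ k, (h n k).isSome := fun n =>
    (hconv n).imp fun k hk => Option.isSome_of_eq_some hk
  refine mem_kleeneApp.2 fun n => ⟨Nat.find (hex n), ?_, fun j hj => ?_⟩
  · obtain ⟨v, hv⟩ := Option.isSome_iff_exists.1 (Nat.find_spec (hex n))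
    rw [ha, hv, hval _ _ _ hv]
    rfl
  · rw [ha, Option.not_isSome_iff_eq_none.1 (Nat.find_min (hex n) hj)]
    rfl

theorem mem_kleeneApp_associate {φ : List ℕ → ℕ → Option ℕ} {q r : Baire}
    (hval : ∀ n k v, φ (initSeg q k) n = some v → v = r n)
    (hconv : ∀ n, ∃ k, φ (initSeg q k) n = some (r n)) : r ∈ kleeneApp (associate φ) q :=
  mem_kleeneApp_of_encode (associate_query φ · q ·) hval hconv

theorem baireComputable_associate {φ : List ℕ → ℕ → Option ℕ} (hφ : Computable₂ φ)
    {F : Baire →. Baire} (hF : ∀ p r, r ∈ F p → r ∈ kleeneApp (associate φ) p) :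
    BaireComputable F :=
  ⟨associate φ, (computable_associate (φ := fun _ : Unit => φ)
    (hφ.comp (Computable.snd.comp Computable.fst) Computable.snd)).comp
      (Computable.const ()) Computable.id, hF⟩

theorem baireComputable_of_initSeg {f : List ℕ → ℕ → ℕ} (hf : Computable₂ f) :
    BaireComputable ((fun p n => f (initSeg p n) n : Baire → Baire) : Baire →. Baire) := by
  have hφ : Computable₂ fun (l : List ℕ) n => bif l.length == n then some (f l n) else none :=
    Computable.cond (Primrec.beq.to_comp.comp (Computable.list_length.comp Computable.fst)
      Computable.snd) (Computable.option_some.comp hf) (Computable.const none)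
  refine baireComputable_associate hφ fun p r hr => ?_
  obtain rfl := Part.mem_some_iff.1 hr
  refine mem_kleeneApp_associate (fun n k v hv => ?_) fun n => ⟨n, by simp [length_initSeg]⟩
  obtain rfl | hk := eq_or_ne k n
  · simpa [length_initSeg, eq_comm] using hv
  · simp [length_initSeg, beq_eq_false_iff_ne.2 hk] at hv

namespace ComputableFunctional

variable {Φ Ψ : Baire → Baire →. Baire}

theorem of_le (h : ComputableFunctional Ψ) (hle : ∀ p q r, r ∈ Φ p q → r ∈ Ψ p q) :
    ComputableFunctional Φ := by
  obtain ⟨φ, hφ, ha⟩ := h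
  exact ⟨φ, hφ, ha.refines, fun hr => ha.converges (hle _ _ _ hr)⟩

theorem swap (h : ComputableFunctional Φ) : ComputableFunctional fun p q => Φ q p := by
  obtain ⟨φ, hφ, ha⟩ := h
  refine ⟨fun l m => φ m l, hφ.comp (((Computable.snd.comp Computable.fst).pair
    (Computable.fst.comp Computable.fst)).pair Computable.snd),
    fun hl hm => ha.refines hm hl, fun hr => ha.converges hr⟩

theorem fst : ComputableFunctional fun p _ => Part.some p := by
  refine ⟨fun l _ n => l[n]?, Computable.list_getElem?.comp
    (Computable.fst.comp Computable.fst) Computable.snd, ?_, fun {p _ r} hr n => ?_⟩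
  · rintro l _ m _ ⟨l', rfl⟩ - n v hv
    exact (List.getElem?_append_left (List.getElem?_eq_some_iff.1 hv).1).trans hv
  · obtain rfl := Part.mem_some_iff.1 hr
    exact ⟨n + 1, initSeg_getElem?_eq_some.2 ⟨n.lt_succ_self, rfl⟩⟩

theorem snd : ComputableFunctional fun _ q => Part.some q := fst.swap

theorem const {a : Baire} (ha : Computable a) : ComputableFunctional fun _ _ => Part.some a := by
  refine ⟨fun _ _ n => some (a n), Computable.option_some.comp (ha.comp Computable.snd),
    fun _ _ _ _ h => h, fun hr n => ⟨0, ?_⟩⟩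
  rw [Part.mem_some_iff.1 hr]

theorem app (hΦ : ComputableFunctional Φ) (hΨ : ComputableFunctional Ψ) :
    ComputableFunctional fun p q => (Φ p q).bind fun f => (Ψ p q).bind (kleeneApp f) := by
  obtain ⟨φ, hφ, ha⟩ := hΦ
  obtain ⟨ψ, hψ, hb⟩ := hΨ
  refine ⟨fun l m n => applyApprox (φ l m) (ψ l m) l.length n, ?_, fun hl hm => ?_,
    fun {p q r} hr n => ?_⟩
  · have harg : Computable fun y : ((List ℕ × List ℕ) × ℕ) × ℕ => (y.1.1, y.2) :=
      (Computable.fst.comp Computable.fst).pair Computable.snd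
    exact computable_applyApprox (α := (List ℕ × List ℕ) × ℕ)
      (f := fun x => φ x.1.1 x.1.2) (g := fun x => ψ x.1.1 x.1.2) (hφ.comp harg) (hψ.comp harg)
      (Computable.list_length.comp (Computable.fst.comp Computable.fst)) Computable.snd
  · exact (ha.refines hl hm).applyApprox (hb.refines hl hm) hl.length_le
  · obtain ⟨f, hf, hr⟩ := Part.mem_bind_iff.1 hr
    obtain ⟨g, hg, hr⟩ := Part.mem_bind_iff.1 hr
    obtain ⟨N, hN⟩ := exists_applyApprox_eq hr n
    obtain ⟨k, hfk, hgk, hk⟩ := ((ha.eventually_eq_below hf N).and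
      ((hb.eventually_eq_below hg N).and (eventually_ge_atTop N))).exists
    have hNk : N ≤ (initSeg p k).length := by rwa [length_initSeg]
    exact ⟨k, Refines.applyApprox (fun _ _ => id) (fun _ _ => id) hNk (hN _ _ hfk hgk)⟩

theorem bind {F : Baire →. Baire} (hΦ : ComputableFunctional Φ) (hF : BaireComputable F) :
    ComputableFunctional fun p q => (Φ p q).bind F := by
  obtain ⟨a, ha, h⟩ := hF
  refine ((const ha).app hΦ).of_le fun p q r hr => ?_
  obtain ⟨s, hs, hr⟩ := Part.mem_bind_iff.1 hr
  exact Part.mem_bind (Part.mem_some a) (Part.mem_bind hs (h s r hr))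

theorem diag (hΦ : ComputableFunctional Φ) : BaireComputable fun p => Φ p p := by
  obtain ⟨φ, hφ, ha⟩ := hΦ
  have hdiag : Computable₂ fun l n => φ l l n :=
    hφ.comp ((Computable.fst.pair Computable.fst).pair Computable.snd)
  exact baireComputable_associate hdiag fun p r hr =>
    mem_kleeneApp_associate (fun _ _ _ => ha.eq_of_mem hr) (ha.converges hr)

/-- A query `c` about `q` is at least as large as the length of the initial segment of `q` that it
codes, so `c` entries of `p` are enough for the `c`-th entry of the associate. -/
theorem curry (hΦ : ComputableFunctional Φ) :
    ∃ F : Baire → Baire, BaireComputable (F : Baire →. Baire) ∧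
      ∀ p q r, r ∈ Φ p q → r ∈ kleeneApp (F p) q := by
  obtain ⟨φ, hφ, ha⟩ := hΦ
  refine ⟨fun p c => associate (φ (initSeg p c)) c,
    baireComputable_of_initSeg (computable_associate hφ), fun p q r hr => ?_⟩
  refine mem_kleeneApp_of_encode (fun n k => associate_query _ n q k)
    (fun _ _ _ => ha.eq_of_mem hr) fun n => ?_
  obtain ⟨k, hk⟩ := ha.converges hr n
  exact ⟨k, ha.refines (initSeg_prefix p (le_query n q k)) List.prefix_rfl hk⟩

end ComputableFunctional

namespace BaireComputable

theorem id : BaireComputable ((fun p => p : Baire → Baire) : Baire →. Baire) :=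
  ComputableFunctional.fst.diag

theorem comp {F G : Baire →. Baire} (hG : BaireComputable G) (hF : BaireComputable F) :
    BaireComputable fun p => (F p).bind G :=
  (((ComputableFunctional.fst.bind hF).bind hG).of_le (Φ := fun p _ => (F p).bind G)
    fun p _ _ hr => (Part.bind_some p F).symm ▸ hr).diag

theorem exists_precomp {F : Baire →. Baire} (hF : BaireComputable F) :
    ∃ J : Baire → Baire, BaireComputable (J : Baire →. Baire) ∧
      ∀ a p s r, s ∈ F p → r ∈ kleeneApp a s → r ∈ kleeneApp (J a) p := by
  obtain ⟨J, hJ, h⟩ := (ComputableFunctional.fst.app (ComputableFunctional.snd.bind hF)).curry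
  exact ⟨J, hJ, fun a p s r hs hr => h a p r <|
    Part.mem_bind (Part.mem_some a) (Part.mem_bind (Part.mem_bind (Part.mem_some p) hs) hr)⟩

end BaireComputable

theorem exists_evaluator :
    ∃ E : Baire → Baire, BaireComputable (E : Baire →. Baire) ∧
      ∀ p a r, r ∈ kleeneApp a p → r ∈ kleeneApp (E p) a := by
  obtain ⟨E, hE, h⟩ := (ComputableFunctional.snd.app ComputableFunctional.fst).curry
  exact ⟨E, hE, fun p a r hr => h p a r <|
    Part.mem_bind (Part.mem_some a) (Part.mem_bind (Part.mem_some p) hr)⟩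

variable {X : RepSpace.{u}} {Y : RepSpace.{v}} {Z : RepSpace.{w}}

theorem computableMap_iff {f : X → Y} :
    ComputableMap f ↔ ∃ F : Baire →. Baire, BaireComputable F ∧
      ∀ p, ∀ x ∈ X.rep p, ∃ r ∈ F p, f x ∈ Y.rep r := by
  simp only [ComputableMap, ComputableMulti, RealizesMulti, Set.singleton_nonempty, true_imp_iff,
    Set.mem_singleton_iff, exists_eq_right]

theorem ComputableMulti.comp {R : X → Set Y} {S : Y → Set Z} {T : X → Set Z}
    (hS : ComputableMulti S) (hR : ComputableMulti R)
    (h : ∀ x, (T x).Nonempty → (R x).Nonempty ∧ ∀ y ∈ R x, (S y).Nonempty ∧ S y ⊆ T x) :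
    ComputableMulti T := by
  obtain ⟨G, hG, hGS⟩ := hS
  obtain ⟨F, hF, hFR⟩ := hR
  refine ⟨_, hG.comp hF, fun p x hx hT => ?_⟩
  obtain ⟨hRx, hST⟩ := h x hT
  obtain ⟨r, hr, y, hy, hyR⟩ := hFR p x hx hRx
  obtain ⟨s, hs, z, hz, hzS⟩ := hGS r y hy (hST y hyR).1
  exact ⟨s, Part.mem_bind hr hs, z, hz, (hST y hyR).2 hzS⟩

namespace ComputableMap

theorem id : ComputableMap (fun x : X => x) :=
  computableMap_iff.2 ⟨_, BaireComputable.id, fun p _ hx => ⟨p, Part.mem_some p, hx⟩⟩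

theorem comp {g : Y → Z} {f : X → Y} (hg : ComputableMap g) (hf : ComputableMap f) :
    ComputableMap (g ∘ f) :=
  ComputableMulti.comp hg hf fun x _ => ⟨singleton_nonempty _, fun y hy =>
    ⟨singleton_nonempty _, by rw [mem_singleton_iff.1 hy, Function.comp_apply]⟩⟩

theorem computableMulti {f : X → Y} (hf : ComputableMap f) {R : X → Set Y}
    (h : ∀ x, f x ∈ R x) : ComputableMulti R := by
  obtain ⟨F, hF, hf⟩ := computableMap_iff.1 hf
  refine ⟨F, hF, fun p x hx _ => ?_⟩
  obtain ⟨r, hr, hy⟩ := hf p x hx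
  exact ⟨r, hr, _, hy, h x⟩

theorem of_total {f : X → Y} {F : Baire → Baire} (hF : BaireComputable (F : Baire →. Baire))
    (h : ∀ p, ∀ x ∈ X.rep p, f x ∈ Y.rep (F p)) : ComputableMap f :=
  computableMap_iff.2 ⟨F, hF, fun p x hx => ⟨F p, Part.mem_some _, h p x hx⟩⟩

end ComputableMap

theorem computableMap_comp_iff {e : Y → Z} (he : ∀ p y, e y ∈ Z.rep p ↔ y ∈ Y.rep p)
    {f : X → Y} : ComputableMap (e ∘ f) ↔ ComputableMap f := by
  simp only [computableMap_iff, Function.comp_apply, he]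

theorem ComputableEmbedding.of_comp {g : Y → Z} {f : X → Y} (hgf : ComputableEmbedding (g ∘ f))
    (hf : ComputableMap f) (hg : ComputableMap g) : ComputableEmbedding f := by
  refine ⟨hgf.1.of_comp, hf, ComputableMulti.comp hgf.2.2 hg ?_⟩
  rintro _ ⟨x, rfl⟩
  refine ⟨singleton_nonempty _, ?_⟩
  rintro _ rfl
  exact ⟨⟨x, rfl⟩, fun x' hx' => congrArg f (hgf.1 hx')⟩

theorem NamesChar.isOpen {p : Baire} {f : X → Prop} (hp : NamesChar p f) : IsOpen {x | f x} := by
  refine isOpen_iff.2 fun q x hx hf => ?_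
  obtain ⟨M, hM⟩ := namesChar_locally hp hx hf
  exact ⟨M, fun q' hq' x' hx' => hM p (fun _ _ => rfl) f hp q' hq' x' hx'⟩

namespace ComputableMap

theorem exists_namesChar_comp {f : X → Y} (hf : ComputableMap f) :
    ∃ J : Baire → Baire, BaireComputable (J : Baire →. Baire) ∧
      ∀ p (g : Y → Prop), NamesChar p g → NamesChar (J p) (g ∘ f) := by
  obtain ⟨F, hF, hf⟩ := computableMap_iff.1 hf
  obtain ⟨J, hJ, h⟩ := hF.exists_precomp
  refine ⟨J, hJ, fun p g hp => namesChar_iff.2 fun q x hx => ?_⟩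
  obtain ⟨s, hs, hfx⟩ := hf q x hx
  obtain ⟨r, hr, hg⟩ := namesChar_iff.1 hp s (f x) hfx
  exact ⟨r, h p q s r hs hr, hg⟩

theorem continuous {f : X → Y} (hf : ComputableMap f) : Continuous f := by
  obtain ⟨J, -, h⟩ := hf.exists_namesChar_comp
  refine continuous_def.2 fun U hU => ?_
  obtain ⟨p, hp⟩ := exists_namesChar hU
  exact (h p _ hp).isOpen

theorem comap {f : C(X, Y)} (hf : ComputableMap f) :
    ComputableMap (X := opens Y) (Y := opens X) (Opens.comap f) := by
  obtain ⟨J, hJ, h⟩ := hf.exists_namesChar_comp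
  exact of_total hJ fun p U hU => mem_opens_rep.2 (h p _ (mem_opens_rep.1 hU))

end ComputableMap

theorem computableMap_nhdMap (X : RepSpace.{u}) : ComputableMap (nhdMap X) := by
  obtain ⟨E, hE, h⟩ := exists_evaluator
  refine ComputableMap.of_total hE fun p x hx =>
    mem_opens_rep.2 (namesChar_iff.2 fun q U hU => ?_)
  obtain ⟨r, hr, hxU⟩ := namesChar_iff.1 (mem_opens_rep.1 hU) p x hx
  exact ⟨r, h p q r hr, hxU⟩

/-- The transpose `y ↦ {x | y ∈ f x}` of a continuous map `f : X → 𝒪(Y)`. -/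
noncomputable def transpose (f : C(X, opens Y)) (y : Y) : Opens X := Opens.comap f (nhdMap Y y)

theorem computableMap_transpose {f : C(X, opens Y)} (hf : ComputableMap f) :
    ComputableMap (Y := opens X) (transpose f) :=
  hf.comap.comp (computableMap_nhdMap Y)

/-- The quantifier `∃_A` of a closed set `A`, as the open set of all `U ∈ 𝒪(Y)` that meet `A`. -/
def existsOpens (A : Closeds Y) : Opens (opens Y) :=
  ⟨{U | existsOn (A : Set Y) U}, isOpen_existsOn (A : Set Y)⟩

/-- The quantifier `∀_K` of a saturated compact set `K`, as the open set of all `U ∈ 𝒪(Y)` that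
contain `K`. -/
def forallOpens (K : SatCompacts Y) : Opens (opens Y) :=
  ⟨{U | forallOn K.1 U}, isOpen_forallOn K.2.1⟩

theorem existsOpens_mem_rep (p : Baire) (A : Closeds Y) :
    existsOpens A ∈ (opens (opens Y)).rep p ↔ A ∈ (closedsPos Y).rep p :=
  (mem_opens_rep (U := existsOpens A)).trans (mem_partialOfRel namesClosed_unique).symm

theorem forallOpens_mem_rep (p : Baire) (K : SatCompacts Y) :
    forallOpens K ∈ (opens (opens Y)).rep p ↔ K ∈ (satCompacts Y).rep p :=
  (mem_opens_rep (U := forallOpens K)).trans (mem_partialOfRel namesSatCompact_unique).symm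

theorem computableMap_existsOpens (Y : RepSpace.{u}) :
    ComputableMap (X := closedsPos Y) (Y := opens (opens Y)) existsOpens :=
  (computableMap_comp_iff (Y := closedsPos Y) existsOpens_mem_rep).2 ComputableMap.id

theorem computableMap_forallOpens (Y : RepSpace.{u}) :
    ComputableMap (X := satCompacts Y) (Y := opens (opens Y)) forallOpens :=
  (computableMap_comp_iff (Y := satCompacts Y) forallOpens_mem_rep).2 ComputableMap.id

theorem existsOpens_closure_singleton (y : Y) :
    existsOpens (Closeds.closure {y}) = nhdMap Y y := by
  refine Opens.ext (Set.ext fun U => ⟨?_, fun hy => ⟨y, subset_closure rfl, hy⟩⟩)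
  rintro ⟨z, hz, hzU⟩
  obtain ⟨_, hyU, rfl⟩ := mem_closure_iff.1 hz _ (asOpens U).isOpen hzU
  exact hyU

theorem computableMap_closure_singleton (Y : RepSpace.{u}) :
    ComputableMap (X := Y) (Y := closedsPos Y) fun y => (Closeds.closure {y} : Closeds Y) := by
  refine (computableMap_comp_iff (Y := closedsPos Y) existsOpens_mem_rep).1 ?_
  convert computableMap_nhdMap Y
  exact funext existsOpens_closure_singleton

theorem mem_iSup_closeds {B : C(Y, opens X)} {A : Closeds Y} {x : X} :
    x ∈ (⨆ y ∈ A, asOpens (B y)) ↔ transpose B x ∈ existsOpens A := by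
  simp only [Opens.mem_iSup, exists_prop]
  rfl

theorem iSup_closure_singleton (B : C(Y, opens X)) (y : Y) :
    ⨆ z ∈ (Closeds.closure {y} : Closeds Y), asOpens (B z) = asOpens (B y) := by
  refine Opens.ext (Set.ext fun x => mem_iSup_closeds.trans ?_)
  rw [existsOpens_closure_singleton]
  rfl

theorem exists_computableMap_comap_transpose {B : C(Y, opens X)} (hB : ComputableMap B) :
    ∃ D : Opens (opens Y) → Opens X, ComputableMap (X := opens (opens Y)) (Y := opens X) D ∧
      ∀ W x, x ∈ D W ↔ transpose B x ∈ W :=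
  ⟨_, ComputableMap.comap (f := ⟨transpose B, (computableMap_transpose hB).continuous⟩)
    (computableMap_transpose hB), fun _ _ => Iff.rfl⟩

theorem computableMap_iSup_closeds {B : C(Y, opens X)} (hB : ComputableMap B) :
    ComputableMap (X := closedsPos Y) (Y := opens X)
      fun A : Closeds Y => (⨆ y ∈ A, asOpens (B y) : Opens X) := by
  obtain ⟨D, hD, hmem⟩ := exists_computableMap_comap_transpose hB
  have hD_eq : (fun A : Closeds Y => (⨆ y ∈ A, asOpens (B y) : Opens X)) = D ∘ existsOpens :=
    funext fun A => Opens.ext (Set.ext fun x => mem_iSup_closeds.trans (hmem _ x).symm)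
  rw [hD_eq]
  exact hD.comp (computableMap_existsOpens Y)

theorem exists_computableMap_iInter_satCompacts {B : C(Y, opens X)} (hB : ComputableMap B) :
    ∃ I : SatCompacts Y → Opens X, ComputableMap (X := satCompacts Y) (Y := opens X) I ∧
      ∀ K, (I K : Set X) = ⋂ y ∈ K.1, (asOpens (B y) : Set X) := by
  obtain ⟨D, hD, hmem⟩ := exists_computableMap_comap_transpose hB
  refine ⟨_, hD.comp (computableMap_forallOpens Y), fun K => Set.ext fun x => ?_⟩
  simp only [mem_iInter]
  exact hmem _ x

theorem ComputablySurjective.lacombeBase {B : Y → Opens X}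
    (hB : ComputablySurjective (Y := opens X) B) (hX : ComputableKolmogorov X) :
    ComputableLacombeBase X Y B := by
  obtain ⟨hsurj, hcomp, hinv⟩ := hB
  let b : C(Y, opens X) := ⟨B, hcomp.continuous⟩
  have hsup (y : Y) : ⨆ z ∈ Closeds.closure {y}, B z = B y := iSup_closure_singleton b y
  refine ⟨hX, fun U => ?_, computableMap_iSup_closeds (B := b) hcomp,
    ComputableMulti.comp (computableMap_closure_singleton Y) hinv fun U _ => ⟨hsurj U, ?_⟩⟩
  · obtain ⟨y, rfl⟩ := hsurj U
    exact ⟨_, hsup y⟩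
  · rintro y rfl
    refine ⟨singleton_nonempty _, ?_⟩
    rintro _ rfl
    exact hsup y

theorem ComputableKolmogorov.lacombeBase_id (hX : ComputableKolmogorov X) :
    ComputableLacombeBase X (opens X) fun U : Opens X => U :=
  ComputablySurjective.lacombeBase (Y := opens X)
    ⟨fun U => ⟨U, rfl⟩, ComputableMap.id, ComputableMap.id.computableMulti fun _ => rfl⟩ hX

theorem ComputableKolmogorov.presubbase_id (hX : ComputableKolmogorov X) :
    ComputablePresubbase X (opens X) fun U : Opens X => U :=
  ⟨fun x => (nhdMap X x).isOpen, hX⟩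

theorem ComputablePresubbase.computableMap {B : Y → Opens X} (hB : ComputablePresubbase X Y B) :
    ComputableMap (Y := opens X) B := by
  obtain ⟨_, -, hτ, -⟩ := hB
  exact computableMap_transpose (f := ⟨_, hτ.continuous⟩) hτ

theorem ComputablePresubbase.kolmogorov {B : Y → Opens X} (hB : ComputablePresubbase X Y B) :
    ComputableKolmogorov X := by
  let b : C(Y, opens X) := ⟨B, hB.computableMap.continuous⟩
  have hb : ComputableMap b := hB.computableMap
  obtain ⟨_, hτ⟩ := hB
  exact ComputableEmbedding.of_comp (Y := opens (opens X)) (Z := opens Y) (g := Opens.comap b) hτ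
    (computableMap_nhdMap X) hb.comap

theorem ComputableLacombeBase.exists_iSup_eq {B : Y → Opens X} (hB : ComputableLacombeBase X Y B)
    (U : Opens X) : ∃ A : Closeds Y, ⨆ y ∈ A, B y = U :=
  hB.2.1 U

theorem ComputableLacombeBase.isTopologicalBasis {B : Y → Opens X}
    (hB : ComputableLacombeBase X Y B) : IsTopologicalBasis (range fun y => (B y : Set X)) := by
  have hbasis : Opens.IsBasis (range B) := Opens.isBasis_iff_nbhd.2 fun {U x} hx => by
    obtain ⟨A, rfl⟩ := hB.exists_iSup_eq U
    simp only [Opens.mem_iSup] at hx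
    obtain ⟨y, hyA, hxy⟩ := hx
    exact ⟨B y, mem_range_self y, hxy, le_iSup₂ (f := fun y _ => B y) y hyA⟩
  rwa [Opens.IsBasis, ← range_comp] at hbasis

theorem ComputableLacombeBase.base {B : Y → Opens X} (hB : ComputableLacombeBase X Y B)
    (hpre : ComputablePresubbase X Y B) : ComputableBase X Y B := by
  let b : C(Y, opens X) := ⟨B, hpre.computableMap.continuous⟩
  obtain ⟨I, hI, hIK⟩ := exists_computableMap_iInter_satCompacts (B := b) hpre.computableMap
  refine ⟨⟨hpre, ⟨fun K => {A | ⨆ y ∈ A, B y = I K}, fun K => hB.exists_iSup_eq (I K), ?_,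
    fun K A hA => ?_⟩, ?_⟩, hB.isTopologicalBasis⟩
  · refine ComputableMulti.comp hB.2.2.2 hI fun K hK => ⟨singleton_nonempty _, ?_⟩
    rintro _ rfl
    exact ⟨hK, subset_rfl⟩
  · calc ⋂ y ∈ K.1, (B y : Set X) = I K := (hIK K).symm
      _ = (⨆ y ∈ A, B y : Opens X) := congrArg _ hA.symm
      _ = ⋃ y ∈ A, (B y : Set X) := by simp only [Opens.coe_iSup]
  · rw [← sUnion_range, hB.isTopologicalBasis.sUnion_eq]

end CompTop

theorem theorem23 (X : CompTop.RepSpace.{u}) :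
    List.TFAE [
      CompTop.ComputableKolmogorov X,
      ∃ (Y : CompTop.RepSpace.{u}) (B : Y → TopologicalSpace.Opens X),
        CompTop.ComputablePresubbase X Y B,
      ∃ (Y : CompTop.RepSpace.{u}) (B : Y → TopologicalSpace.Opens X),
        CompTop.ComputablePrebase X Y B,
      ∃ (Y : CompTop.RepSpace.{u}) (B : Y → TopologicalSpace.Opens X),
        CompTop.ComputableBase X Y B,
      ∃ (Y : CompTop.RepSpace.{u}) (B : Y → TopologicalSpace.Opens X),
        CompTop.ComputableLacombeBase X Y B,
      CompTop.ComputableLacombeBase X (CompTop.opens X)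
        (fun U : TopologicalSpace.Opens X => U)] := by
  tfae_have 1 → 6 := fun hX => hX.lacombeBase_id
  tfae_have 6 → 5 := fun h => ⟨_, _, h⟩
  tfae_have 5 → 1 := fun ⟨_, _, h⟩ => h.1
  tfae_have 1 → 4 := fun hX => ⟨_, _, hX.lacombeBase_id.base hX.presubbase_id⟩
  tfae_have 4 → 3 := fun ⟨Y, B, h⟩ => ⟨Y, B, h.1⟩
  tfae_have 3 → 2 := fun ⟨Y, B, h⟩ => ⟨Y, B, h.1⟩
  tfae_have 2 → 1 := fun ⟨_, _, h⟩ => h.kolmogorov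
  tfae_finish
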